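/- A Grothendieck abelian category is called \emph{locally noetherian} if it has a generating set consisting of noetherian objects (objects whose subobjects satisfy the ascending chain condition). Let $\Gamma_{\mathrm{inj}}$ be the category of finite sets and injective maps. Let $\Gamma_{\mathrm{os}}$ be the category whose objects are the sets $\mathbf n=\{1,\dots,n\}$, $n\ge 0$, and whose morphisms $f\colon\mathbf m\to\mathbf n$ are the \emph{ordered surjections}, i.e. the surjections such that $i<j$ implies $\min f^{-1}(i)<\min f^{-1}(j)$. For such $f$ let $f^!\colon\mathbf n\to\mathbf m$ be the injective map $f^!(i)=\min f^{-1}(i)$. A functor $\phi\colon\mathcal C\to\mathcal D$ is called \emph{contravariantly finite} if every object of $\mathcal D$ is isomorphic to $\phi(x)$ for some $x\in\mathcal C$, and for every $y\in\mathcal D$ there are finitely many objects $x_1,\dots,x_n\in\mathcal C$ and a finite chain $$\bigsqcup_{i=1}^n\mathcal C(-,x_i)=F_0\twoheadrightarrow F_1\leftarrowtail F_2\twoheadrightarrow\cdots\twoheadrightarrow F_{r-1}\leftarrowtail F_r=\mathcal D(\phi(-),y)$$ of epimorphisms and monomorphisms of functors $\mathcal C^{\mathrm{op}}\to\mathrm{Set}$.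 \textbf{Theorem.} (1) If $\mathcal A$ is a locally noetherian Grothendieck abelian category, then the functor category $\mathrm{Fun}(\Gamma_{\mathrm{inj}},\mathcal A)$ is a locally noetherian Grothendieck abelian category. (2) The assignment $\mathbf n\mapsto\mathbf n$, $f\mapsto f^!$ defines a contravariantly finite functor $\Gamma_{\mathrm{os}}\to\Gamma_{\mathrm{inj}}^{\mathrm{op}}$. -/

import Mathlib

open CategoryTheory CategoryTheory.Limits Opposite

universe w v u t v₁ u₁ v₂ u₂

/-- A locally noetherian Grothendieck abelian category: a Grothendieck abelian category which has
a (small) generating set of noetherian objects. The universe `w` is the one in which the category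
is locally small, and in which generating sets and filtered colimits are taken. -/
structure IsLocallyNoetherianGrothendieck (A : Type u) [Category.{v} A] [Abelian A] : Prop where
  isGrothendieckAbelian : IsGrothendieckAbelian.{w} A
  exists_noetherian_generators : ∃ (ι : Type w) (G : ι → A),
    (∀ i, IsNoetherianObject (G i)) ∧ (ObjectProperty.ofObj G).IsSeparating

/-- The category of finite sets and injective maps (its objects). -/
structure FinInj : Type (t + 1) where
  /-- The underlying set. -/
  carrier : Type t
  [finite : Finite carrier]

namespace FinInj

/-- Morphisms are injective maps, with the usual composition. -/
instance : Category.{t} FinInj.{t} where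
  Hom X Y := X.carrier ↪ Y.carrier
  id X := Function.Embedding.refl X.carrier
  comp f g := Function.Embedding.trans f g

end FinInj

/-- `minFiber f hf i` is the least element of the fibre of the surjection `f` over `i`;
thus `minFiber f hf` is the map written `f^!`. -/
def minFiber {m n : ℕ} (f : Fin m → Fin n) (hf : Function.Surjective f) (i : Fin n) : Fin m :=
  (Finset.univ.filter fun k => f k = i).min'
    ((hf i).imp fun k hk => Finset.mem_filter.2 ⟨Finset.mem_univ k, hk⟩)

theorem apply_minFiber {m n : ℕ} (f : Fin m → Fin n) (hf : Function.Surjective f) (i : Fin n) :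
    f (minFiber f hf i) = i :=
  (Finset.mem_filter.1 (Finset.min'_mem (Finset.univ.filter fun k => f k = i) _)).2

theorem minFiber_le {m n : ℕ} (f : Fin m → Fin n) (hf : Function.Surjective f) (k : Fin m) :
    minFiber f hf (f k) ≤ k :=
  Finset.min'_le (Finset.univ.filter fun l => f l = f k) k
    (Finset.mem_filter.2 ⟨Finset.mem_univ k, rfl⟩)

theorem minFiber_eq {m n : ℕ} (f : Fin m → Fin n) (hf : Function.Surjective f) (i : Fin n)
    (k : Fin m) (hk : f k = i) (hle : ∀ l, f l = i → k ≤ l) : minFiber f hf i = k :=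
  le_antisymm (by subst hk; exact minFiber_le f hf k) (hle _ (apply_minFiber f hf i))

/-- A map between standard finite sets is an ordered surjection if it is surjective and `i < j`
implies `min f⁻¹(i) < min f⁻¹(j)`. -/
def IsOrderedSurjection {m n : ℕ} (f : Fin m → Fin n) : Prop :=
  ∃ hf : Function.Surjective f, StrictMono (minFiber f hf)

theorem minFiber_id (n : ℕ) (i : Fin n) :
    minFiber (id : Fin n → Fin n) Function.surjective_id i = i :=
  minFiber_eq _ _ _ _ rfl fun _ hl => (show _ = i from hl).ge

theorem minFiber_comp {l m n : ℕ} {f : Fin l → Fin m} {g : Fin m → Fin n}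
    (hf : IsOrderedSurjection f) (hg : IsOrderedSurjection g) (i : Fin n) :
    minFiber (g ∘ f) (hg.1.comp hf.1) i = minFiber f hf.1 (minFiber g hg.1 i) := by
  refine minFiber_eq _ _ _ _ ?_ fun k hk => ?_
  · simp [apply_minFiber]
  · subst hk
    exact (hf.2.monotone (minFiber_le g hg.1 (f k))).trans (minFiber_le f hf.1 k)

theorem IsOrderedSurjection.id (n : ℕ) : IsOrderedSurjection (id : Fin n → Fin n) :=
  ⟨Function.surjective_id, fun i j h => by simpa only [minFiber_id] using h⟩

theorem IsOrderedSurjection.comp {l m n : ℕ} {f : Fin l → Fin m} {g : Fin m → Fin n}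
    (hg : IsOrderedSurjection g) (hf : IsOrderedSurjection f) : IsOrderedSurjection (g ∘ f) :=
  ⟨hg.1.comp hf.1, fun i j h => by
    simpa only [minFiber_comp hf hg] using hf.2 (hg.2 h)⟩

/-- The category of the standard finite sets `Fin n`, `n ≥ 0`, and ordered surjections
(its objects). -/
structure FinOrdSurj : Type where
  /-- The number of elements. -/
  card : ℕ

namespace FinOrdSurj

/-- Morphisms are ordered surjections, with the usual composition. -/
instance : Category.{0} FinOrdSurj where
  Hom m n := { f : Fin m.card → Fin n.card // IsOrderedSurjection f }
  id m := ⟨id, IsOrderedSurjection.id m.card⟩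
  comp f g := ⟨g.1 ∘ f.1, g.2.comp f.2⟩

/-- The functor from standard finite sets and ordered surjections to the opposite of finite sets
and injections which is the identity on objects (up to a universe lift) and takes `f` to `f^!`. -/
def toFinInjOp : FinOrdSurj ⥤ FinInj.{t}ᵒᵖ where
  obj n := op ⟨ULift.{t} (Fin n.card)⟩
  map f := Quiver.Hom.op (V := FinInj.{t})
    { toFun := fun i => ULift.up (minFiber f.1 f.2.1 i.down)
      inj' := fun _ _ h => ULift.down_injective (f.2.2.injective (congrArg ULift.down h)) }
  map_id m := by
    refine Quiver.Hom.unop_inj (Function.Embedding.ext fun i => ?_)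
    exact congrArg ULift.up (minFiber_id m.card i.down)
  map_comp f g := by
    refine Quiver.Hom.unop_inj (Function.Embedding.ext fun i => ?_)
    exact congrArg ULift.up (minFiber_comp f.2 g.2 i.down)

end FinOrdSurj

/-- The relation `F ⇝ G`: there is a finite chain `F = F₀ ↠ F₁ ↢ F₂ ↠ ⋯ ↠ Fₙ₋₁ ↢ Fₙ = G` of
epimorphisms and monomorphisms of functors. Since identities are both, the two kinds of
steps may be taken in any order. -/
def LeadsTo {C : Type u₁} [Category.{v₁} C] : (Cᵒᵖ ⥤ Type w) → (Cᵒᵖ ⥤ Type w) → Prop :=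
  Relation.ReflTransGen fun F G => (∃ p : F ⟶ G, Epi p) ∨ (∃ i : G ⟶ F, Mono i)

/-- A functor `φ : C ⥤ D` is contravariantly finite if every object of `D` is isomorphic to some
`φ(x)`, and for every object `y` of `D` there are objects `x₁, …, xₙ` of `C` with
`C(-, x₁) ⊔ ⋯ ⊔ C(-, xₙ) ⇝ D(φ -, y)`. (Both sides are lifted to a common universe.) -/
def IsContravariantlyFinite {C : Type u₁} [Category.{v₁} C] {D : Type u₂} [Category.{v₂} D]
    (φ : C ⥤ D) : Prop :=
  (∀ y : D, ∃ x : C, Nonempty (φ.obj x ≅ y)) ∧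
  ∀ y : D, ∃ (n : ℕ) (x : Fin n → C),
    LeadsTo (∐ fun i : Fin n => uliftYoneda.{v₂}.obj (x i)) (φ.op ⋙ uliftYoneda.{v₁}.obj y)

/-! (1) By Yoneda, the functors `free n M`, with `M` in a generating set of noetherian objects,
generate; limits, colimits and exactness are pointwise. It remains to see that `free n M` is
noetherian, by a Gröbner argument. On standard sets, order the injective words lexicographically; a
subfunctor then has, at each word, a subobject of `M` of leading coefficients. These grow along
divisibility of words (`lead_le_of_dvd`), and nested subfunctors with equal leading coefficients
agree (`isIso_of_lead_le`). Divisibility is a well-quasi-order, so ascending chains stop. (2) The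
maps `f^!` are the strictly increasing maps whose image contains the least element, if there is one.
Hence an injection from `Y` factors through the `f^!` on its image together with that element, and
finitely many representables cover the functor by one epimorphism. -/

/-- Monotone families of elements of a noetherian order indexed by a well-quasi-order satisfy the
ascending chain condition. -/
theorem not_strictMono_of_wellQuasiOrdered {Q N : Type*} {r : Q → Q → Prop} [IsPreorder Q r]
    (hr : WellQuasiOrdered r) [PartialOrder N] [WellFoundedGT N] (a : ℕ → Q → N)
    (ha : Monotone a) (hmono : ∀ j q q', r q q' → a j q ≤ a j q') : ¬ StrictMono a := by
  intro hs
  have key : ∀ j, ∃ q, a j q < a (j + 1) q := fun j => by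
    obtain ⟨hle, q, hq⟩ := Pi.lt_def.1 (hs (Nat.lt_succ_self j))
    exact ⟨q, hq⟩
  choose q hq using key
  -- Each `q j` witnesses a jump at stage `j`; once these witnesses increase, the jumps add up to
  -- one infinite chain in `N`.
  obtain ⟨g, hg⟩ := hr.exists_monotone_subseq q
  refine not_strictMono_of_wellFoundedGT (fun k => a (g k) (q (g k)))
    (strictMono_nat_of_lt_succ fun k => ?_)
  calc a (g k) (q (g k)) < a (g k + 1) (q (g k)) := hq _
    _ ≤ a (g (k + 1)) (q (g k)) := ha (g.strictMono (Nat.lt_succ_self k)) _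
    _ ≤ a (g (k + 1)) (q (g (k + 1))) := hmono _ _ _ (hg _ _ (Nat.le_succ k))

/-! ### Well-quasi-order on injective words -/

/-- A strictly increasing map `Fin m → Fin m'` carrying the word `f` to the word `g` exists as soon
as all letters and gaps of `f` are bounded by those of `g`. -/
theorem exists_strictMono_comp_eq {n m m' : ℕ} (f : Fin n → Fin m) (hf : Function.Injective f)
    (g : Fin n → Fin m') (hle : m ≤ m') (h₁ : ∀ i, (f i : ℕ) ≤ g i)
    (h₂ : ∀ i, m - (f i : ℕ) ≤ m' - g i)
    (h₃ : ∀ i j, (f j : ℕ) - f i ≤ (g j : ℕ) - g i) :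
    ∃ h : Fin m → Fin m', StrictMono h ∧ ∀ i, h (f i) = g i := by
  -- The map is `k ↦ k + s k`, where `s k` is the largest shift required by a letter up to `k`. By
  -- `h₃` shifts grow with the letter, so `s` is exact at each `f i`; `h₂` keeps the values below
  -- `m'`.
  let s : ℕ → ℕ := fun k => (Finset.univ.filter fun i => (f i : ℕ) ≤ k).sup fun i => (g i : ℕ) - f i
  have hs : Monotone s := fun k l hkl => Finset.sup_mono fun i hi => by
    simp only [Finset.mem_filter, Finset.mem_univ, true_and] at hi ⊢
    omega
  have hsm : ∀ k, s k ≤ m' - m := fun k => Finset.sup_le fun i _ => by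
    have := h₁ i; have := h₂ i; have := (f i).2; have := (g i).2
    omega
  refine ⟨fun k => ⟨k + s k, ?_⟩, fun k l hkl => ?_, fun i => Fin.ext ?_⟩
  · have := hsm k; have := k.2
    omega
  · have hkl' : (k : ℕ) < l := hkl
    have := hs hkl'.le
    simp only [Fin.lt_def]
    omega
  · have : s (f i) = (g i : ℕ) - f i := by
      refine le_antisymm (Finset.sup_le fun j hj => ?_)
        (Finset.le_sup (f := fun i => (g i : ℕ) - f i) (by simp))
      simp only [Finset.mem_filter, Finset.mem_univ, true_and] at hj
      rcases eq_or_ne i j with rfl | hij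
      · rfl
      · have := h₃ j i; have := h₁ i; have := h₁ j
        have : (f j : ℕ) ≠ f i := fun e => hij (hf (Fin.ext e.symm))
        omega
    have := h₁ i
    simp only [‹s (f i) = _›]
    omega

/-- Injective words of length `n`, in all finite alphabets `Fin m`. -/
abbrev InjWord (n : ℕ) : Type := Σ m : ℕ, Fin n ↪ Fin m

/-- A word divides another one if it is carried to it by a strictly increasing map of alphabets. -/
def InjWord.Dvd {n : ℕ} (a b : InjWord n) : Prop :=
  ∃ h : Fin a.1 → Fin b.1, StrictMono h ∧ ∀ i, h (a.2 i) = b.2 i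

instance (n : ℕ) : IsPreorder (InjWord n) InjWord.Dvd where
  refl _ := ⟨id, strictMono_id, fun _ => rfl⟩
  trans _ _ _ := fun ⟨h, hh, e⟩ ⟨h', hh', e'⟩ =>
    ⟨h' ∘ h, hh'.comp hh, fun i => by rw [Function.comp_apply, e, e']⟩

/-- Dickson's lemma: a word is encoded by finitely many natural numbers, and componentwise
comparison of the codes implies divisibility. -/
theorem InjWord.wellQuasiOrdered_dvd (n : ℕ) : WellQuasiOrdered (InjWord.Dvd (n := n)) := by
  intro a
  let c : InjWord n → ℕ × (Fin n → ℕ) × (Fin n → ℕ) × (Fin n → Fin n → ℕ) := fun b =>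
    (b.1, fun i => b.2 i, fun i => b.1 - b.2 i, fun i j => (b.2 j : ℕ) - b.2 i)
  obtain ⟨k, l, hkl, h⟩ := wellQuasiOrdered_le (fun k => c (a k))
  exact ⟨k, l, hkl, exists_strictMono_comp_eq _ (a k).2.injective _ h.1 h.2.1 h.2.2.1 h.2.2.2⟩

attribute [local instance] Abelian.hasFiniteBiproducts

/-! ### Leading coefficients in finite direct sums -/

section LeadingCoefficient

variable {A : Type u} [Category.{v} A] [Abelian A] {M : A} {J : Type*} [Finite J]
  {L : Type*} [LinearOrder L] (κ : J → L)

/-- The map from a direct sum of copies of `M` to the partial sum of the summands beyond `a`. -/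
noncomputable def tailProj (M : A) (a : J) :
    (⨁ fun _ : J => M) ⟶ ⨁ fun _ : {b : J // κ a < κ b} => M :=
  biproduct.lift fun b => biproduct.π (fun _ : J => M) b.1

theorem comp_tailProj_eq_zero_iff {T : A} (x : T ⟶ ⨁ fun _ : J => M) (a : J) :
    x ≫ tailProj κ M a = 0 ↔ ∀ b, κ a < κ b → x ≫ biproduct.π _ b = 0 := by
  constructor
  · intro h b hb
    simpa [tailProj] using h =≫ biproduct.π _ (⟨b, hb⟩ : {b : J // κ a < κ b})
  · intro h
    refine biproduct.hom_ext _ _ fun b => ?_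
    simpa [tailProj] using h b.1 b.2

/-- The object of coefficients at `a` of those elements of `U ⟶ ⨁ M` whose coefficients beyond `a`
vanish. -/
noncomputable def leadCoeff {U : A} (i : U ⟶ ⨁ fun _ : J => M) (a : J) : Subobject M :=
  imageSubobject (kernel.ι (i ≫ tailProj κ M a) ≫ i ≫ biproduct.π _ a)

/-- Replaces reasoning with elements: membership in an image can be tested after passing to an
epimorphic cover. -/
theorem leadCoeff_factors_iff {U : A} (i : U ⟶ ⨁ fun _ : J => M) (a : J) {T : A} (x : T ⟶ M) :
    (leadCoeff κ i a).Factors x ↔ ∃ (T' : A) (p : T' ⟶ T) (_ : Epi p) (y : T' ⟶ U),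
      (∀ b, κ a < κ b → (y ≫ i) ≫ biproduct.π _ b = 0) ∧ (y ≫ i) ≫ biproduct.π _ a = p ≫ x := by
  constructor
  · intro h
    rw [leadCoeff] at h
    obtain ⟨T', p, hp, z, hz⟩ := surjective_up_to_refinements_of_epi
      (factorThruImageSubobject (kernel.ι (i ≫ tailProj κ M a) ≫ i ≫ biproduct.π _ a))
      ((imageSubobject _).factorThru x h)
    refine ⟨T', p, hp, z ≫ kernel.ι _, ?_, ?_⟩
    · rw [← comp_tailProj_eq_zero_iff]
      simp
    · simpa using (hz =≫ (imageSubobject _).arrow).symm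
  · rintro ⟨T', p, hp, y, h₁, h₂⟩
    rw [← comp_tailProj_eq_zero_iff, Category.assoc] at h₁
    have hpx : (leadCoeff κ i a).Factors (p ≫ x) := by
      rw [← h₂, leadCoeff]
      have : (y ≫ i) ≫ biproduct.π _ a =
          kernel.lift _ y h₁ ≫ kernel.ι _ ≫ i ≫ biproduct.π (fun _ : J => M) a := by simp
      rw [this]
      exact Subobject.factors_of_factors_right _ (by
        simpa using imageSubobject_factors_comp_self (𝟙 _)
          (f := kernel.ι (i ≫ tailProj κ M a) ≫ i ≫ biproduct.π (fun _ : J => M) a))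
    have : x ≫ cokernel.π (leadCoeff κ i a).arrow = 0 := by
      rw [← cancel_epi p, ← Category.assoc, ← Subobject.factorThru_arrow _ _ hpx, Category.assoc,
        cokernel.condition, comp_zero, comp_zero]
    rw [← Abelian.monoLift_comp _ _ this]
    exact Subobject.factors_comp_arrow _

/-- Relabelling along `e` creates no coefficients outside its range, and by `he` a summand in the
range beyond `e a` comes from one beyond `a`. -/
theorem leadCoeff_le {U : A} (i : U ⟶ ⨁ fun _ : J => M) (a : J)
    {J' : Type*} [Finite J'] {L' : Type*} [LinearOrder L'] (κ' : J' → L')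
    {U' : A} (i' : U' ⟶ ⨁ fun _ : J' => M) (a' : J')
    (e : J ↪ J') (he : ∀ b c, κ' (e b) < κ' (e c) → κ b < κ c) (ha : e a = a') (f : U ⟶ U')
    (hf : f ≫ i' = i ≫ biproduct.desc fun b => biproduct.ι (fun _ : J' => M) (e b)) :
    leadCoeff κ i a ≤ leadCoeff κ' i' a' := by
  classical
  subst ha
  have hπ : ∀ b, biproduct.desc (fun b => biproduct.ι (fun _ : J' => M) (e b)) ≫
      biproduct.π _ (e b) = biproduct.π (fun _ : J => M) b := fun b => by
    refine biproduct.hom_ext' _ _ fun c => ?_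
    simp only [biproduct.ι_desc_assoc, biproduct.ι_π, e.injective.eq_iff]
  have hπ' : ∀ b', b' ∉ Set.range e →
      biproduct.desc (fun b => biproduct.ι (fun _ : J' => M) (e b)) ≫
      biproduct.π _ b' = 0 := fun b' hb' => by
    refine biproduct.hom_ext' _ _ fun c => ?_
    rw [biproduct.ι_desc_assoc, comp_zero, biproduct.ι_π_ne _ (fun h => hb' ⟨c, h⟩)]
  have h := (leadCoeff_factors_iff κ i a (leadCoeff κ i a).arrow).1
    (by simpa using Subobject.factors_comp_arrow (P := leadCoeff κ i a) (𝟙 _))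
  obtain ⟨T, p, hp, y, h₁, h₂⟩ := h
  refine Subobject.le_of_comm (Subobject.factorThru _ _ ((leadCoeff_factors_iff κ' i' (e a) _).2
    ⟨T, p, hp, y ≫ f, fun b' hb' => ?_, ?_⟩)) (Subobject.factorThru_arrow _ _ _)
  · simp only [Category.assoc, hf]
    by_cases hb : b' ∈ Set.range e
    · obtain ⟨b, rfl⟩ := hb
      rw [hπ, ← Category.assoc]
      exact h₁ b (he _ _ hb')
    · simp [hπ' b' hb]
  · simp only [Category.assoc, hf, hπ]
    simpa using h₂

/-- Two nested subobjects of a finite direct sum with the same leading coefficients are equal. -/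
theorem epi_of_leadCoeff_le (hκ : Function.Injective κ) {U V : A} (j : U ⟶ V)
    (i : V ⟶ ⨁ fun _ : J => M) [Mono i] (h : ∀ a, leadCoeff κ i a ≤ leadCoeff κ (j ≫ i) a) :
    Epi j := by
  classical
  have := Fintype.ofFinite J
  let : LinearOrder J := LinearOrder.lift' κ hκ
  rw [epi_iff_surjective_up_to_refinements]
  -- Division algorithm: induct on a lower set containing the support, subtracting an element of `U`
  -- with the same leading coefficient.
  suffices H : ∀ s : Finset J, IsLowerSet (s : Set J) → ∀ ⦃T : A⦄ (y : T ⟶ V),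
      (∀ b, b ∉ s → (y ≫ i) ≫ biproduct.π _ b = 0) →
      ∃ (T' : A) (p : T' ⟶ T) (_ : Epi p) (x : T' ⟶ U), p ≫ y = x ≫ j by
    exact fun T y => H Finset.univ (by simpa using isLowerSet_univ) y (by simp)
  intro s
  induction s using Finset.induction_on_max with
  | empty =>
    intro _ T y hy
    have : y = 0 := by
      rw [← cancel_mono i, zero_comp]
      exact biproduct.hom_ext _ _ fun b => by simpa using hy b (by simp)
    exact ⟨T, 𝟙 T, inferInstance, 0, by simp [this]⟩
  | insert a s hs ih =>
    intro hlow T y hy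
    have hlow' : IsLowerSet (s : Set J) := fun x z hzx hx => by
      have hz := hlow hzx (Finset.mem_coe.2 (Finset.mem_insert_of_mem hx))
      rcases Finset.mem_insert.1 (Finset.mem_coe.1 hz) with rfl | hz
      · exact absurd (hs x hx) (not_lt.2 hzx)
      · exact hz
    have hgt : ∀ b, a < b → b ∉ insert a s := fun b hb hmem => by
      rcases Finset.mem_insert.1 hmem with rfl | hmem
      · exact lt_irrefl _ hb
      · exact lt_asymm hb (hs b hmem)
    have hfac : (leadCoeff κ i a).Factors ((y ≫ i) ≫ biproduct.π _ a) :=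
      (leadCoeff_factors_iff κ i a _).2 ⟨T, 𝟙 T, inferInstance, y,
        fun b hb => hy b (hgt b hb), by simp⟩
    obtain ⟨T₁, p₁, hp₁, x₁, h₁, h₂⟩ := (leadCoeff_factors_iff κ (j ≫ i) a _).1
      (Subobject.factors_of_le _ (h a) hfac)
    obtain ⟨T₂, p₂, hp₂, x₂, h₃⟩ := ih hlow' (p₁ ≫ y - x₁ ≫ j) fun b hb => by
      rw [Preadditive.sub_comp, Preadditive.sub_comp, sub_eq_zero]
      simp only [Category.assoc] at h₁ h₂ hy ⊢
      rcases lt_trichotomy b a with hba | rfl | hab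
      · have hb' := hlow hba.le (Finset.mem_coe.2 (Finset.mem_insert_self a s))
        rcases Finset.mem_insert.1 (Finset.mem_coe.1 hb') with rfl | hb'
        · exact absurd hba (lt_irrefl _)
        · exact absurd hb' hb
      · exact h₂.symm
      · rw [hy b (hgt b hab), comp_zero, h₁ b hab]
    exact ⟨T₂, p₂ ≫ p₁, inferInstance, x₂ + p₂ ≫ x₁, by
      rw [Preadditive.add_comp, ← h₃]; simp⟩

end LeadingCoefficient

/-! ### Free functors and generation -/

namespace FinInj

attribute [instance] FinInj.finite

/-- The standard set with `n` elements. -/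
abbrev std (n : ℕ) : FinInj.{t} := ⟨ULift.{t} (Fin n)⟩

/-- An injective map as a morphism. -/
def homMk {X Y : FinInj.{t}} (f : X.carrier ↪ Y.carrier) : X ⟶ Y := f

/-- A bijection of finite sets is an isomorphism. -/
def isoMk {X Y : FinInj.{t}} (e : X.carrier ≃ Y.carrier) : X ≅ Y where
  hom := homMk e.toEmbedding
  inv := homMk e.symm.toEmbedding
  hom_inv_id := Function.Embedding.ext fun x => e.symm_apply_apply x
  inv_hom_id := Function.Embedding.ext fun x => e.apply_symm_apply x

theorem exists_iso_std (X : FinInj.{t}) : ∃ n, Nonempty (X ≅ std n) := by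
  obtain ⟨n, ⟨e⟩⟩ := Finite.exists_equiv_fin X.carrier
  exact ⟨n, ⟨isoMk (e.trans Equiv.ulift.symm)⟩⟩

/-- A morphism of functors is an isomorphism if it is so on the standard sets. -/
theorem isIso_of_isIso_std {A : Type u} [Category.{v} A] {F G : FinInj.{t} ⥤ A} (α : F ⟶ G)
    (h : ∀ n, IsIso (α.app (std n))) : IsIso α := by
  have (X : FinInj.{t}) : IsIso (α.app X) := by
    obtain ⟨n, ⟨e⟩⟩ := exists_iso_std X
    have := h n
    have : α.app X = F.map e.hom ≫ α.app (std n) ≫ inv (G.map e.hom) := by simp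
    rw [this]
    infer_instance
  exact NatIso.isIso_of_isIso_app α

theorem hom_ext_std {A : Type u} [Category.{v} A] {F G : FinInj.{t} ⥤ A} {α β : F ⟶ G}
    (h : ∀ n, α.app (std n) = β.app (std n)) : α = β := by
  ext X
  obtain ⟨n, ⟨e⟩⟩ := exists_iso_std X
  rw [← cancel_mono (G.map e.hom), ← α.naturality, ← β.naturality, h n]

/-- Countably many components determine a transformation, so the universe `t` plays no role. -/
theorem locallySmall_functor {A : Type u} [Category.{v} A] [LocallySmall.{w} A] :
    LocallySmall.{w} (FinInj.{t} ⥤ A) where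
  hom_small F G := small_of_injective (β := ∀ n : ℕ, F.obj (std n) ⟶ G.obj (std n))
    (f := fun α n => α.app (std n)) fun _ _ h => hom_ext_std fun n => congrFun h n

variable {A : Type u} [Category.{v} A] [Abelian A]

/-- The functor taking a finite set `X` to the direct sum of copies of `M` indexed by the
injective maps from the standard set with `n` elements to `X`. -/
noncomputable def free (n : ℕ) (M : A) : FinInj.{t} ⥤ A where
  obj X := ⨁ fun _ : Fin n ↪ X.carrier => M
  map {X Y} h := biproduct.desc fun f =>
    biproduct.ι (fun _ : Fin n ↪ Y.carrier => M) (f.trans (show X.carrier ↪ Y.carrier from h))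
  map_id X := biproduct.hom_ext' _ _ fun f => by
    rw [biproduct.ι_desc, Category.comp_id]
    rfl
  map_comp {X Y Z} h k := biproduct.hom_ext' _ _ fun f => by
    rw [biproduct.ι_desc, biproduct.ι_desc_assoc, biproduct.ι_desc]
    rfl

/-- The inclusion of the summand of `free n M` at `f`. -/
noncomputable def freeι {n : ℕ} (M : A) {X : FinInj.{t}} (f : Fin n ↪ X.carrier) :
    M ⟶ (free n M).obj X :=
  biproduct.ι (fun _ : Fin n ↪ X.carrier => M) f

theorem free_hom_ext {n : ℕ} {M B : A} {X : FinInj.{t}} {x y : (free n M).obj X ⟶ B}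
    (h : ∀ f, freeι M f ≫ x = freeι M f ≫ y) : x = y :=
  biproduct.hom_ext' _ _ h

theorem freeι_map {n : ℕ} {M : A} {X Y : FinInj.{t}} (h : X ⟶ Y) (f : Fin n ↪ X.carrier) :
    freeι M f ≫ (free n M).map h = freeι M (f.trans (show X.carrier ↪ Y.carrier from h)) :=
  biproduct.ι_desc _ _

/-- The component at `X` of the morphism of functors from `free n M` given by a morphism
from `M`. -/
noncomputable def freeDescApp {n : ℕ} {M : A} {F : FinInj.{t} ⥤ A} (x : M ⟶ F.obj (std n))
    (X : FinInj.{t}) : (free n M).obj X ⟶ F.obj X :=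
  biproduct.desc fun f => x ≫ F.map (homMk (Equiv.ulift.toEmbedding.trans f))

theorem freeι_freeDescApp {n : ℕ} {M : A} {F : FinInj.{t} ⥤ A} (x : M ⟶ F.obj (std n))
    (X : FinInj.{t}) (f : Fin n ↪ X.carrier) :
    freeι M f ≫ freeDescApp x X = x ≫ F.map (homMk (Equiv.ulift.toEmbedding.trans f)) :=
  biproduct.ι_desc _ _

/-- The morphism of functors from `free n M` given by a morphism from `M`. -/
noncomputable def freeDesc {n : ℕ} {M : A} {F : FinInj.{t} ⥤ A} (x : M ⟶ F.obj (std n)) :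
    free n M ⟶ F where
  app := freeDescApp x
  naturality X Y h := free_hom_ext fun f => by
    rw [← Category.assoc, freeι_map, freeι_freeDescApp, ← Category.assoc, freeι_freeDescApp,
      Category.assoc, ← F.map_comp]
    rfl

theorem freeι_freeDesc_app {n : ℕ} {M : A} {F : FinInj.{t} ⥤ A} (x : M ⟶ F.obj (std n)) :
    freeι (X := std n) M Equiv.ulift.symm.toEmbedding ≫ (freeDesc x).app (std n) = x := by
  refine (freeι_freeDescApp x _ _).trans ?_
  have : homMk (X := std n) (Y := std n)
    (Equiv.ulift.toEmbedding.trans Equiv.ulift.symm.toEmbedding) = 𝟙 (std.{t} n) :=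
    Function.Embedding.ext fun _ => rfl
  rw [this, F.map_id, Category.comp_id]

theorem isSeparating_free {ι : Type w} {G : ι → A} (hG : (ObjectProperty.ofObj G).IsSeparating) :
    (ObjectProperty.ofObj fun a : ℕ × ι =>
      (free a.1 (G a.2) : FinInj.{t} ⥤ A)).IsSeparating := by
  intro F F' α β h
  refine hom_ext_std fun n => hG _ _ ?_
  rintro _ ⟨i⟩ x
  have := h _ (ObjectProperty.ofObj_apply (fun a : ℕ × ι => (free a.1 (G a.2) : FinInj.{t} ⥤ A))
    (n, i)) (freeDesc x)
  have := NatTrans.congr_app this (std n)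
  rw [NatTrans.comp_app, NatTrans.comp_app] at this
  rw [← freeι_freeDesc_app x, Category.assoc, this, Category.assoc]

theorem isGrothendieckAbelian_functor {ι : Type w} {G : ι → A}
    (hG : (ObjectProperty.ofObj G).IsSeparating) [IsGrothendieckAbelian.{w} A] :
    IsGrothendieckAbelian.{w} (FinInj.{t} ⥤ A) where
  locallySmall := locallySmall_functor
  hasFilteredColimitsOfSize := ⟨fun _ _ _ => inferInstance⟩
  ab5OfSize := ⟨fun _ _ _ => inferInstance⟩
  hasSeparator := ⟨_, (isSeparating_free hG).isSeparator_coproduct⟩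

/-! ### Noetherianity of free functors -/

/-- The word of natural numbers given by an injective map to a standard set, with the lexicographic
order on such words. -/
def key {n m : ℕ} (f : Fin n ↪ ULift.{t} (Fin m)) : Lex (Fin n → Fin m) :=
  toLex fun i => (f i).down

theorem key_injective {n m : ℕ} : Function.Injective (key.{t} (n := n) (m := m)) := fun _ _ h =>
  Function.Embedding.ext fun i => ULift.down_injective (congrFun (toLex.injective h) i)

/-- The map of standard sets induced by a strictly increasing map. -/
def stdMap {m m' : ℕ} (h : Fin m → Fin m') (hh : StrictMono h) :
    ULift.{t} (Fin m) ↪ ULift.{t} (Fin m') :=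
  ⟨fun k => ⟨h k.down⟩, fun _ _ e => ULift.down_injective (hh.injective (congrArg ULift.down e))⟩

/-- Strictly increasing maps respect the lexicographic order, which arbitrary injections need not;
hence their use in `InjWord.Dvd`. -/
theorem key_stdMap_lt {n m m' : ℕ} (h : Fin m → Fin m') (hh : StrictMono h)
    (f g : Fin n ↪ ULift.{t} (Fin m))
    (hlt : key (f.trans (stdMap h hh)) < key (g.trans (stdMap h hh))) : key f < key g := by
  obtain ⟨i, h₁, h₂⟩ := hlt
  exact ⟨i, fun j hj => hh.injective (h₁ j hj), hh.lt_iff_lt.1 h₂⟩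

/-- The leading coefficients of a subfunctor of `free n M`. -/
noncomputable def lead {n : ℕ} {M : A} {U : FinInj.{t} ⥤ A} (i : U ⟶ free n M) (a : InjWord n) :
    Subobject M :=
  leadCoeff key (i.app (std a.1)) (a.2.trans Equiv.ulift.symm.toEmbedding)

theorem lead_le_of_dvd {n : ℕ} {M : A} {U : FinInj.{t} ⥤ A} (i : U ⟶ free n M) {a b : InjWord n}
    (hab : a.Dvd b) : lead i a ≤ lead i b := by
  obtain ⟨h, hh, e⟩ := hab
  exact leadCoeff_le key (i.app (std a.1)) _ key (i.app (std b.1)) _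
    ⟨fun f => f.trans (stdMap h hh), fun _ _ hfg => Function.Embedding.ext fun x =>
      (stdMap h hh).injective (DFunLike.congr_fun hfg x)⟩
    (key_stdMap_lt h hh) (Function.Embedding.ext fun x => congrArg ULift.up (e x))
    (U.map (homMk (X := std a.1) (Y := std b.1) (stdMap h hh))) (i.naturality _)

theorem lead_comp_le {n : ℕ} {M : A} {U V : FinInj.{t} ⥤ A} (j : U ⟶ V) (i : V ⟶ free n M)
    (a : InjWord n) : lead (j ≫ i) a ≤ lead i a := by
  refine leadCoeff_le key ((j ≫ i).app (std a.1)) _ key (i.app (std a.1)) _ (.refl _)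
    (fun _ _ h => h) rfl (j.app (std a.1)) ?_
  have : biproduct.desc (fun b => biproduct.ι (fun _ : Fin n ↪ ULift.{t} (Fin a.1) => M)
      (Function.Embedding.refl _ b)) = 𝟙 _ := biproduct.hom_ext' _ _ fun b => by simp
  rw [this]
  exact (Category.comp_id _).symm

theorem isIso_of_lead_le {n : ℕ} {M : A} {U V : FinInj.{t} ⥤ A} (j : U ⟶ V) [Mono j]
    (i : V ⟶ free n M) [Mono i] (h : ∀ a, lead i a ≤ lead (j ≫ i) a) : IsIso j := by
  refine isIso_of_isIso_std j fun m => ?_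
  have : Mono (j.app (std m)) := inferInstance
  have hi : Mono (i.app (std m)) := inferInstance
  have : Epi (j.app (std m)) := by
    change @Mono A _ _ (⨁ fun _ : Fin n ↪ ULift.{t} (Fin m) => M) (i.app (std m)) at hi
    refine epi_of_leadCoeff_le key key_injective (j.app (std m)) (i.app (std m)) fun a => ?_
    exact h ⟨m, a.trans Equiv.ulift.toEmbedding⟩
  exact isIso_of_mono_of_epi _

/-- If `M` is noetherian, so is `free n M`. -/
theorem isNoetherianObject_free (n : ℕ) (M : A) [IsNoetherianObject M] :
    IsNoetherianObject (free n M : FinInj.{t} ⥤ A) := by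
  rw [isNoetherianObject_iff_not_strictMono]
  intro U hU
  have hle : ∀ {V W : Subobject (free n M : FinInj.{t} ⥤ A)}, V ≤ W → ∀ a,
      lead V.arrow a ≤ lead W.arrow a := fun {V W} h a => by
    rw [← Subobject.ofLE_arrow h]
    exact lead_comp_le _ _ _
  refine not_strictMono_of_wellQuasiOrdered (InjWord.wellQuasiOrdered_dvd n)
    (fun j a => lead (U j).arrow a) (fun j k hjk a => hle (hU.monotone hjk) a)
    (fun j a b hab => lead_le_of_dvd _ hab) fun j k hjk => ?_
  refine lt_of_le_of_ne (fun a => hle (hU hjk).le a) fun heq => (hU hjk).not_ge ?_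
  have : IsIso (Subobject.ofLE _ _ (hU hjk).le) := by
    refine isIso_of_lead_le _ (U k).arrow fun a => ?_
    rw [Subobject.ofLE_arrow]
    exact (congrFun heq a).ge
  exact Subobject.le_of_comm (inv (Subobject.ofLE _ _ (hU hjk).le)) (by simp)

/-- Functors from finite sets and injections to a locally noetherian category form a locally
noetherian category. -/
theorem isLocallyNoetherianGrothendieck_functor (h : IsLocallyNoetherianGrothendieck.{w} A) :
    IsLocallyNoetherianGrothendieck.{w} (FinInj.{t} ⥤ A) := by
  obtain ⟨hA, ι, G, hG, hsep⟩ := h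
  exact ⟨isGrothendieckAbelian_functor hsep, ℕ × ι, fun a => free a.1 (G a.2),
    fun a => have := hG a.2; isNoetherianObject_free _ _, isSeparating_free hsep⟩

end FinInj

/-! ### Contravariant finiteness -/

/-- A strictly increasing map whose values reach below every element is of the form `f^!` for an
ordered surjection `f`. -/
theorem exists_minFiber_eq {m n : ℕ} (h : Fin n → Fin m) (hh : StrictMono h)
    (h₀ : ∀ k, ∃ i, h i ≤ k) :
    ∃ (f : Fin m → Fin n) (hf : IsOrderedSurjection f), minFiber f hf.1 = h := by
  have hne : ∀ k, (Finset.univ.filter fun i => h i ≤ k).Nonempty := fun k => by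
    obtain ⟨i, hi⟩ := h₀ k
    exact ⟨i, by simpa using hi⟩
  -- Each `k` goes to the last `i` with `h i ≤ k`; thus `h i` is the first point of its fibre.
  let f : Fin m → Fin n := fun k => (Finset.univ.filter fun i => h i ≤ k).max' (hne k)
  have hle : ∀ k, h (f k) ≤ k := fun k =>
    (Finset.mem_filter.1 (Finset.max'_mem (Finset.univ.filter fun i => h i ≤ k) (hne k))).2
  have hfh : ∀ i, f (h i) = i := fun i =>
    le_antisymm (hh.le_iff_le.1 (hle (h i))) (Finset.le_max' _ _ (by simp))
  have hf : Function.Surjective f := fun i => ⟨h i, hfh i⟩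
  have hmin : minFiber f hf = h := funext fun i =>
    minFiber_eq f hf i (h i) (hfh i) fun l hl => hl ▸ hle l
  exact ⟨f, ⟨hf, hmin ▸ hh⟩, hmin⟩

namespace FinOrdSurj

/-- Every injective map to a standard set factors through some `f^!` whose source has at most one
element more than the source of the given map. -/
theorem exists_factorization {Y : Type t} [Finite Y] {m : ℕ} (g : Y ↪ ULift.{t} (Fin m)) :
    ∃ (l : ℕ) (_ : l < Nat.card Y + 2) (g' : Y ↪ ULift.{t} (Fin l)) (f : Fin m → Fin l)
      (hf : IsOrderedSurjection f), ∀ y, g y = ⟨minFiber f hf.1 (g' y).down⟩ := by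
  classical
  have := Fintype.ofFinite Y
  -- The filter adds the least element when `m > 0` and nothing when `m = 0`.
  let S : Finset (Fin m) :=
    Finset.univ.image (fun y => (g y).down) ∪ Finset.univ.filter fun k => (k : ℕ) = 0
  have hgS : ∀ y, (g y).down ∈ S := fun y =>
    Finset.mem_union_left _ (Finset.mem_image_of_mem _ (Finset.mem_univ y))
  have hS : S.card < Nat.card Y + 2 := by
    have h₁ : (Finset.univ.image fun y => (g y).down).card ≤ Nat.card Y := by
      rw [Nat.card_eq_fintype_card]
      exact Finset.card_image_le
    have h₂ : (Finset.univ.filter fun k : Fin m => (k : ℕ) = 0).card ≤ 1 :=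
      Finset.card_le_one.2 fun a ha b hb => Fin.ext (by
        rw [(Finset.mem_filter.1 ha).2, (Finset.mem_filter.1 hb).2])
    have := Finset.card_union_le (Finset.univ.image fun y => (g y).down)
      (Finset.univ.filter fun k : Fin m => (k : ℕ) = 0)
    change (_ ∪ _ : Finset (Fin m)).card < _
    omega
  let e := S.orderIsoOfFin rfl
  obtain ⟨f, hf, hmin⟩ := exists_minFiber_eq (fun i => (e i : Fin m))
    (fun i j hij => e.strictMono hij)
    fun k => by
      have h₀ : (⟨0, k.pos⟩ : Fin m) ∈ S := Finset.mem_union_right _ (by simp)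
      exact ⟨e.symm ⟨_, h₀⟩, by simp [Fin.le_def]⟩
  refine ⟨S.card, hS, ⟨fun y => ⟨e.symm ⟨_, hgS y⟩⟩, fun y z h => ?_⟩, f, hf, fun y => ?_⟩
  · have := e.symm.injective (ULift.up_injective h)
    exact g.injective (ULift.down_injective (congrArg Subtype.val this))
  · rw [hmin]
    exact congrArg ULift.up (congrArg Subtype.val (e.apply_symm_apply ⟨_, hgS y⟩)).symm

/-- The functor from finite sets and ordered surjections to the opposite category of finite sets
and injections is contravariantly finite. -/
theorem isContravariantlyFinite_toFinInjOp : IsContravariantlyFinite toFinInjOp.{t} := by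
  refine ⟨fun y => ?_, fun y => ?_⟩
  · obtain ⟨n, ⟨e⟩⟩ := FinInj.exists_iso_std y.unop
    exact ⟨⟨n⟩, ⟨e.op⟩⟩
  · let I : Type t := Σ l : Fin (Nat.card y.unop.carrier + 2), (y.unop.carrier ↪ ULift.{t} (Fin l))
    obtain ⟨N, ⟨e⟩⟩ := Finite.exists_equiv_fin I
    let F := toFinInjOp.{t}.op ⋙ uliftYoneda.{0}.obj y
    let x : Fin N → FinOrdSurj := fun i => ⟨(e.symm i).1⟩
    -- The generators are all injections from the given set into standard sets with at most one more
    -- element.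
    let s : ∀ i, F.obj (op (x i)) := fun i =>
      ⟨Quiver.Hom.op (V := FinInj.{t}) (FinInj.homMk (Y := FinInj.std _) (e.symm i).2)⟩
    refine ⟨N, x, Relation.ReflTransGen.single (.inl
      ⟨Sigma.desc fun i => (uliftYonedaEquiv.{t} (F := F)).symm (s i), ⟨fun {T} α β h => ?_⟩⟩)⟩
    have hs : ∀ i, α.app _ (s i) = β.app _ (s i) := fun i => by
      have := Sigma.ι (fun i => uliftYoneda.{t}.obj (x i)) i ≫= h
      rw [Sigma.ι_desc_assoc, Sigma.ι_desc_assoc] at this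
      simpa [uliftYonedaEquiv_comp] using congrArg uliftYonedaEquiv.{t} this
    ext ⟨⟨m⟩⟩ ⟨g⟩
    obtain ⟨l, hl, g', f, hf, hg⟩ :=
      exists_factorization (show y.unop.carrier ↪ ULift.{t} (Fin m) from g.unop)
    let φ : (⟨m⟩ : FinOrdSurj) ⟶ ⟨l⟩ := ⟨f, hf⟩
    have key : ∀ z : F.obj (op ⟨l⟩), α.app _ z = β.app _ z →
        α.app _ (F.map φ.op z) = β.app _ (F.map φ.op z) := fun z hz => by
      rw [NatTrans.naturality_apply, NatTrans.naturality_apply, hz]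
    let z : ∀ a : I, F.obj (op ⟨a.1⟩) := fun a =>
      ⟨Quiver.Hom.op (V := FinInj.{t}) (FinInj.homMk (Y := FinInj.std a.1) a.2)⟩
    have hz : ∀ a : I, α.app _ (z a) = β.app _ (z a) := fun a => by
      obtain ⟨i, rfl⟩ := e.symm.surjective a
      exact hs i
    have hgz : (⟨g⟩ : F.obj (op ⟨m⟩)) = F.map φ.op (z ⟨⟨l, hl⟩, g'⟩) :=
      congrArg ULift.up (Quiver.Hom.unop_inj (show g.unop = _ from Function.Embedding.ext hg))
    exact hgz ▸ key _ (hz ⟨⟨l, hl⟩, g'⟩)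

end FinOrdSurj

theorem mainTheorem6 :
    (∀ (A : Type u) [Category.{v} A] [Abelian A],
      IsLocallyNoetherianGrothendieck.{w} A →
        IsLocallyNoetherianGrothendieck.{w} (FinInj.{t} ⥤ A)) ∧
    IsContravariantlyFinite FinOrdSurj.toFinInjOp.{t} := by
  exact ⟨fun _ _ _ => FinInj.isLocallyNoetherianGrothendieck_functor,
    FinOrdSurj.isContravariantlyFinite_toFinInjOp⟩
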